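/- Let $F$ be Thompson's group: the group of all piecewise-linear homeomorphisms of $[0,1]$ onto itself that are differentiable except at finitely many dyadic rationals and whose slopes are integral powers of $2$, with composition from left to right (in $fg$, $f$ is applied first). Let $x_0,x_1\in F$ be the elements $$x_0(x)=\begin{cases}2x & 0\le x\le \frac14\\ x+\frac14 & \frac14\le x\le\frac12\\ \frac{x+1}{2} & \frac12\le x\le 1\end{cases}\qquad x_1(x)=\begin{cases}x & 0\le x\le\frac12\\ 2x-\frac12 & \frac12\le x\le\frac58\\ x+\frac18 & \frac58\le x\le\frac34\\ \frac{x+1}{2} & \frac34\le x\le 1\end{cases}$$ and let $X=\{x_0,x_1,x_0^{-1},x_1^{-1}\}$, the standard generating set of $F$. For $g\in F$ let $|g|_X$ be the least length of a word over $X$ that represents $g$; $|w|$ is the length of a word $w$. An automatic structure on a group $G$ consists of a finite generating set $S\subseteq G$ closed under inversion and a language $K$ over the alphabet $S$ such that (i) $K$ is regular, i.e. recognized by a finite state automaton; (ii) every element of $G$ is represented by at least one word of $K$; (iii) for every $s\in S$, the set of pairs $(u,v)\in K\times K$ with $u=vs$ in $G$ is recognized by a finite state automaton that reads $u$ and $v$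 synchronously, the shorter word being extended at its end by a padding symbol. $K$ is called the language of the automatic structure. **Theorem 1.1.** Let $L$ be a language over the alphabet $X$, and suppose that there is an integer $c\ge 0$ such that every $g\in F$ is represented by a word $w\in L$ with $|w|\le |g|_X+c$. Then $L$ is not a subset of the language of any automatic structure on $F$ (over any finite symmetric generating set $S$ of $F$). In particular (case $c=0$), there is no automatic structure on $F$ with alphabet $X$ whose language contains a geodesic representative, i.e. a word of length $|g|_X$, of each $g\in F$: $F$ is not weakly geodesically automatic with respect to $X$. -/

import Mathlib

namespace Thompson

/-- A dyadic rational number. -/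
def IsDyadic (r : ℝ) : Prop := ∃ (a : ℤ) (b : ℕ), r = a / 2 ^ b

/-- `f` is piecewise linear: there is a finite set `D` of dyadic rationals such that, on every
interval `[p, q]` with no point of `D` in its interior, `f` is affine, with slope an integral
power of `2`. -/
def IsDyadicPL (f : unitInterval ≃ₜ unitInterval) : Prop :=
  ∃ D : Set unitInterval, D.Finite ∧ (∀ d ∈ D, IsDyadic (d : ℝ)) ∧
    ∀ p q : unitInterval, p < q → Disjoint (Set.Ioo p q) D →
      ∃ k : ℤ, ∀ x ∈ Set.Icc p q, ∀ y ∈ Set.Icc p q,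
        ((f y : ℝ) - (f x : ℝ)) = (2 : ℝ) ^ k * ((y : ℝ) - (x : ℝ))

theorem IsDyadic.add {r s : ℝ} (hr : IsDyadic r) (hs : IsDyadic s) : IsDyadic (r + s) := by
  obtain ⟨a, b, rfl⟩ := hr
  obtain ⟨c, d, rfl⟩ := hs
  refine ⟨a * 2 ^ d + c * 2 ^ b, b + d, ?_⟩
  push_cast
  field_simp
  ring

theorem IsDyadic.neg {r : ℝ} (hr : IsDyadic r) : IsDyadic (-r) := by
  obtain ⟨a, b, rfl⟩ := hr
  exact ⟨-a, b, by push_cast; ring⟩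

theorem IsDyadic.sub {r s : ℝ} (hr : IsDyadic r) (hs : IsDyadic s) : IsDyadic (r - s) := by
  rw [sub_eq_add_neg]
  exact hr.add hs.neg

theorem IsDyadic.zpow_mul {r : ℝ} (hr : IsDyadic r) (k : ℤ) : IsDyadic ((2 : ℝ) ^ k * r) := by
  obtain ⟨a, b, rfl⟩ := hr
  obtain ⟨n, rfl | rfl⟩ := k.eq_nat_or_neg
  · exact ⟨2 ^ n * a, b, by push_cast; rw [zpow_natCast]; ring⟩
  · exact ⟨a, b + n, by rw [zpow_neg, zpow_natCast, pow_add]; field_simp⟩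

theorem isDyadic_zero : IsDyadic 0 := ⟨0, 0, by simp⟩

theorem pieces_induction {D : Set unitInterval} (hD : D.Finite)
    {P : unitInterval → unitInterval → Prop}
    (base : ∀ p q, p < q → Disjoint (Set.Ioo p q) D → P p q)
    (glue : ∀ p d q, d ∈ D → P p d → P d q → P p q) (p q : unitInterval) (hpq : p < q) :
    P p q := by
  induction hn : (D ∩ Set.Ioo p q).ncard using Nat.strong_induction_on generalizing p q with
  | _ n ih =>
    by_cases h : Disjoint (Set.Ioo p q) D
    · exact base p q hpq h
    · obtain ⟨d, hd, hdD⟩ := Set.not_disjoint_iff.1 h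
      have hfin : (D ∩ Set.Ioo p q).Finite := hD.subset Set.inter_subset_left
      have h1 : (D ∩ Set.Ioo p d).ncard < n := by
        rw [← hn]
        refine Set.ncard_lt_ncard ⟨?_, fun hs => ?_⟩ hfin
        · exact fun x hx => ⟨hx.1, hx.2.1, hx.2.2.trans hd.2⟩
        · exact lt_irrefl d (hs ⟨hdD, hd⟩).2.2
      have h2 : (D ∩ Set.Ioo d q).ncard < n := by
        rw [← hn]
        refine Set.ncard_lt_ncard ⟨?_, fun hs => ?_⟩ hfin
        · exact fun x hx => ⟨hx.1, hd.1.trans hx.2.1, hx.2.2⟩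
        · exact lt_irrefl d (hs ⟨hdD, hd⟩).2.1
      exact glue p d q hdD (ih _ h1 p d hd.1 rfl) (ih _ h2 d q hd.2 rfl)

theorem IsDyadicPL.strictMono {f : unitInterval ≃ₜ unitInterval} (hf : IsDyadicPL f) :
    StrictMono f := by
  obtain ⟨D, hD, -, h⟩ := hf
  intro p q hpq
  refine pieces_induction hD (P := fun p q => f p < f q) ?_
    (fun _ _ _ _ h1 h2 => h1.trans h2) p q hpq
  intro p q hpq hdis
  obtain ⟨k, hk⟩ := h p q hpq hdis
  have h1 := hk p ⟨le_rfl, hpq.le⟩ q ⟨hpq.le, le_rfl⟩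
  have h2 : (0 : ℝ) < 2 ^ k * ((q : ℝ) - p) :=
    mul_pos (by positivity) (sub_pos.2 (by exact_mod_cast hpq))
  have h3 : (f p : ℝ) < f q := by linarith
  exact_mod_cast h3

theorem IsDyadicPL.isDyadic_iff {f : unitInterval ≃ₜ unitInterval} (hf : IsDyadicPL f)
    (x : unitInterval) : IsDyadic (f x : ℝ) ↔ IsDyadic (x : ℝ) := by
  have hmono := hf.strictMono
  obtain ⟨D, hD, hdy, h⟩ := hf
  have h0 : f 0 = 0 := by
    obtain ⟨y, hy⟩ := f.surjective 0
    have h1 : f 0 ≤ f y := hmono.monotone unitInterval.nonneg'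
    exact le_antisymm (h1.trans hy.le) unitInterval.nonneg'
  rcases eq_or_lt_of_le (unitInterval.nonneg' : 0 ≤ x) with hx | hx
  · rw [← hx, h0]
  · refine pieces_induction hD (P := fun p q => IsDyadic (p : ℝ) → IsDyadic (f p : ℝ) →
      (IsDyadic (f q : ℝ) ↔ IsDyadic (q : ℝ))) ?_ ?_ 0 x hx ?_ ?_
    · intro p q hpq hdis hp hfp
      obtain ⟨k, hk⟩ := h p q hpq hdis
      have h1 := hk p ⟨le_rfl, hpq.le⟩ q ⟨hpq.le, le_rfl⟩
      constructor
      · intro hq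
        have e : (q : ℝ) = p + 2 ^ (-k) * ((f q : ℝ) - f p) := by
          rw [h1, ← mul_assoc, ← zpow_add₀ two_ne_zero]
          simp
        rw [e]
        exact hp.add ((hq.sub hfp).zpow_mul _)
      · intro hq
        have e : (f q : ℝ) = f p + 2 ^ k * ((q : ℝ) - p) := by rw [← h1]; ring
        rw [e]
        exact hfp.add ((hq.sub hp).zpow_mul _)
    · intro p d q hd h1 h2 hp hfp
      exact h2 (hdy d hd) ((h1 hp hfp).2 (hdy d hd))
    · simpa using isDyadic_zero
    · rw [h0]
      simpa using isDyadic_zero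

theorem IsDyadicPL.one : IsDyadicPL 1 :=
  ⟨∅, Set.finite_empty, by simp, fun _ _ _ _ => ⟨0, fun x _ y _ => by simp⟩⟩

theorem IsDyadicPL.mul {f g : unitInterval ≃ₜ unitInterval} (hf : IsDyadicPL f)
    (hg : IsDyadicPL g) : IsDyadicPL (g * f) := by
  have hmono := hf.strictMono
  have hiff := hf.isDyadic_iff
  obtain ⟨D, hD, hdy, h⟩ := hf
  obtain ⟨E, hE, edy, h'⟩ := hg
  refine ⟨D ∪ f ⁻¹' E, hD.union (hE.preimage f.injective.injOn), ?_, ?_⟩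
  · rintro d (hd | hd)
    · exact hdy d hd
    · exact (hiff d).1 (edy _ hd)
  · intro p q hpq hdis
    rw [Set.disjoint_union_right] at hdis
    obtain ⟨k, hk⟩ := h p q hpq hdis.1
    obtain ⟨l, hl⟩ := h' (f p) (f q) (hmono hpq) (by
      rw [Set.disjoint_left]
      intro e he heE
      obtain ⟨x, rfl⟩ := f.surjective e
      exact Set.disjoint_left.1 hdis.2 ⟨hmono.lt_iff_lt.1 he.1, hmono.lt_iff_lt.1 he.2⟩ heE)
    refine ⟨l + k, fun x hx y hy => ?_⟩
    have h1 := hl (f x) ⟨hmono.monotone hx.1, hmono.monotone hx.2⟩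
      (f y) ⟨hmono.monotone hy.1, hmono.monotone hy.2⟩
    rw [hk x hx y hy] at h1
    rw [zpow_add₀ two_ne_zero, mul_assoc]
    exact h1

theorem IsDyadicPL.inv {f : unitInterval ≃ₜ unitInterval} (hf : IsDyadicPL f) :
    IsDyadicPL f⁻¹ := by
  have hmono := hf.strictMono
  have hiff := hf.isDyadic_iff
  obtain ⟨D, hD, hdy, h⟩ := hf
  refine ⟨f '' D, hD.image f, ?_, ?_⟩
  · rintro _ ⟨d, hd, rfl⟩
    exact (hiff d).2 (hdy d hd)
  · intro p q hpq hdis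
    obtain ⟨p, rfl⟩ := f.surjective p
    obtain ⟨q, rfl⟩ := f.surjective q
    obtain ⟨k, hk⟩ := h p q (hmono.lt_iff_lt.1 hpq) (by
      rw [Set.disjoint_left]
      exact fun d hd hdD => Set.disjoint_left.1 hdis ⟨hmono hd.1, hmono hd.2⟩ ⟨d, hdD, rfl⟩)
    refine ⟨-k, fun x hx y hy => ?_⟩
    obtain ⟨x, rfl⟩ := f.surjective x
    obtain ⟨y, rfl⟩ := f.surjective y
    have ex : f⁻¹ (f x) = x := f.symm_apply_apply x
    have ey : f⁻¹ (f y) = y := f.symm_apply_apply y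
    rw [ex, ey, hk x ⟨hmono.le_iff_le.1 hx.1, hmono.le_iff_le.1 hx.2⟩
      y ⟨hmono.le_iff_le.1 hy.1, hmono.le_iff_le.1 hy.2⟩, ← mul_assoc,
      ← zpow_add₀ two_ne_zero]
    simp

/-- Thompson's group `F`, with composition from left to right: in the product `f * g` the
homeomorphism `f` is applied first. (In Mathlib's group of homeomorphisms it is applied last,
hence the opposite group.) -/
def F : Subgroup (unitInterval ≃ₜ unitInterval)ᵐᵒᵖ where
  carrier := {f | IsDyadicPL f.unop}
  one_mem' := IsDyadicPL.one
  mul_mem' := fun hf hg => IsDyadicPL.mul hf hg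
  inv_mem' := fun hf => IsDyadicPL.inv hf

/-- The homeomorphism `x₀` of `[0, 1]`. -/
noncomputable def x₀Homeo : unitInterval ≃ₜ unitInterval where
  toFun x := ⟨if (x : ℝ) ≤ 1 / 4 then 2 * x else if (x : ℝ) ≤ 1 / 2 then x + 1 / 4
    else (x + 1) / 2, by
      obtain ⟨x, h0, h1⟩ := x
      dsimp only
      constructor <;> split_ifs <;> linarith⟩
  invFun y := ⟨if (y : ℝ) ≤ 1 / 2 then y / 2 else if (y : ℝ) ≤ 3 / 4 then y - 1 / 4
    else 2 * y - 1, by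
      obtain ⟨y, h0, h1⟩ := y
      dsimp only
      constructor <;> split_ifs <;> linarith⟩
  left_inv x := by
    obtain ⟨x, h0, h1⟩ := x
    apply Subtype.ext
    dsimp only
    split_ifs <;> linarith
  right_inv y := by
    obtain ⟨y, h0, h1⟩ := y
    apply Subtype.ext
    dsimp only
    split_ifs <;> linarith
  continuous_toFun := by
    refine Continuous.subtype_mk ?_ _
    refine Continuous.if_le (by fun_prop) (Continuous.if_le (by fun_prop) (by fun_prop)
      (by fun_prop) (by fun_prop) ?_) (by fun_prop) (by fun_prop) ?_ <;>
    · intro x hx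
      rw [hx]
      norm_num
  continuous_invFun := by
    refine Continuous.subtype_mk ?_ _
    refine Continuous.if_le (by fun_prop) (Continuous.if_le (by fun_prop) (by fun_prop)
      (by fun_prop) (by fun_prop) ?_) (by fun_prop) (by fun_prop) ?_ <;>
    · intro x hx
      rw [hx]
      norm_num

/-- The homeomorphism `x₁` of `[0, 1]`. -/
noncomputable def x₁Homeo : unitInterval ≃ₜ unitInterval where
  toFun x := ⟨if (x : ℝ) ≤ 1 / 2 then x else if (x : ℝ) ≤ 5 / 8 then 2 * x - 1 / 2
    else if (x : ℝ) ≤ 3 / 4 then x + 1 / 8 else (x + 1) / 2, by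
      obtain ⟨x, h0, h1⟩ := x
      dsimp only
      constructor <;> split_ifs <;> linarith⟩
  invFun y := ⟨if (y : ℝ) ≤ 1 / 2 then y else if (y : ℝ) ≤ 3 / 4 then y / 2 + 1 / 4
    else if (y : ℝ) ≤ 7 / 8 then y - 1 / 8 else 2 * y - 1, by
      obtain ⟨y, h0, h1⟩ := y
      dsimp only
      constructor <;> split_ifs <;> linarith⟩
  left_inv x := by
    obtain ⟨x, h0, h1⟩ := x
    apply Subtype.ext
    dsimp only
    split_ifs <;> linarith
  right_inv y := by
    obtain ⟨y, h0, h1⟩ := y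
    apply Subtype.ext
    dsimp only
    split_ifs <;> linarith
  continuous_toFun := by
    refine Continuous.subtype_mk ?_ _
    refine Continuous.if_le (by fun_prop) (Continuous.if_le (by fun_prop)
      (Continuous.if_le (by fun_prop) (by fun_prop) (by fun_prop) (by fun_prop) ?_)
      (by fun_prop) (by fun_prop) ?_) (by fun_prop) (by fun_prop) ?_ <;>
    · intro x hx
      rw [hx]
      norm_num
  continuous_invFun := by
    refine Continuous.subtype_mk ?_ _
    refine Continuous.if_le (by fun_prop) (Continuous.if_le (by fun_prop)
      (Continuous.if_le (by fun_prop) (by fun_prop) (by fun_prop) (by fun_prop) ?_)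
      (by fun_prop) (by fun_prop) ?_) (by fun_prop) (by fun_prop) ?_ <;>
    · intro x hx
      rw [hx]
      norm_num

theorem le_or_le_of_disjoint {D : Set unitInterval} {p q : unitInterval}
    (h : Disjoint (Set.Ioo p q) D) {r : ℝ} (hr : r ∈ Set.Icc (0 : ℝ) 1)
    (hD : (⟨r, hr⟩ : unitInterval) ∈ D) : (q : ℝ) ≤ r ∨ r ≤ (p : ℝ) := by
  by_contra! hc
  exact Set.disjoint_left.1 h ⟨hc.2, hc.1⟩ hD

theorem x₀Homeo_isDyadicPL : IsDyadicPL x₀Homeo := by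
  refine ⟨{⟨1 / 4, by norm_num⟩, ⟨1 / 2, by norm_num⟩}, by simp, ?_, ?_⟩
  · rintro d (rfl | rfl)
    · exact ⟨1, 2, by norm_num⟩
    · exact ⟨1, 1, by norm_num⟩
  · intro p q hpq hdis
    have h1 := le_or_le_of_disjoint hdis (r := 1 / 4) (by norm_num) (by simp)
    have h2 := le_or_le_of_disjoint hdis (r := 1 / 2) (by norm_num) (by simp)
    have key : ∃ k : ℤ, (k = 1 ∧ (q : ℝ) ≤ 1 / 4) ∨
        (k = 0 ∧ (1 / 4 : ℝ) ≤ p ∧ (q : ℝ) ≤ 1 / 2) ∨ (k = -1 ∧ (1 / 2 : ℝ) ≤ p) := by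
      rcases h1 with h1 | h1
      · exact ⟨1, Or.inl ⟨rfl, h1⟩⟩
      · rcases h2 with h2 | h2
        · exact ⟨0, Or.inr (Or.inl ⟨rfl, h1, h2⟩)⟩
        · exact ⟨-1, Or.inr (Or.inr ⟨rfl, h2⟩)⟩
    obtain ⟨k, hk⟩ := key
    refine ⟨k, fun x hx y hy => ?_⟩
    have hx1 : (p : ℝ) ≤ x := hx.1
    have hx2 : (x : ℝ) ≤ q := hx.2
    have hy1 : (p : ℝ) ≤ y := hy.1
    have hy2 : (y : ℝ) ≤ q := hy.2
    simp only [x₀Homeo, Homeomorph.homeomorph_mk_coe, Equiv.coe_fn_mk]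
    rcases hk with ⟨rfl, h⟩ | ⟨rfl, h, h'⟩ | ⟨rfl, h⟩ <;> norm_num <;> split_ifs <;> linarith

theorem x₁Homeo_isDyadicPL : IsDyadicPL x₁Homeo := by
  refine ⟨{⟨1 / 2, by norm_num⟩, ⟨5 / 8, by norm_num⟩, ⟨3 / 4, by norm_num⟩}, by simp, ?_, ?_⟩
  · rintro d (rfl | rfl | rfl)
    · exact ⟨1, 1, by norm_num⟩
    · exact ⟨5, 3, by norm_num⟩
    · exact ⟨3, 2, by norm_num⟩
  · intro p q hpq hdis
    have h1 := le_or_le_of_disjoint hdis (r := 1 / 2) (by norm_num) (by simp)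
    have h2 := le_or_le_of_disjoint hdis (r := 5 / 8) (by norm_num) (by simp)
    have h3 := le_or_le_of_disjoint hdis (r := 3 / 4) (by norm_num) (by simp)
    have key : ∃ k : ℤ, (k = 0 ∧ (q : ℝ) ≤ 1 / 2) ∨
        (k = 1 ∧ (1 / 2 : ℝ) ≤ p ∧ (q : ℝ) ≤ 5 / 8) ∨
        (k = 0 ∧ (5 / 8 : ℝ) ≤ p ∧ (q : ℝ) ≤ 3 / 4) ∨ (k = -1 ∧ (3 / 4 : ℝ) ≤ p) := by
      rcases h1 with h1 | h1
      · exact ⟨0, Or.inl ⟨rfl, h1⟩⟩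
      · rcases h2 with h2 | h2
        · exact ⟨1, Or.inr (Or.inl ⟨rfl, h1, h2⟩)⟩
        · rcases h3 with h3 | h3
          · exact ⟨0, Or.inr (Or.inr (Or.inl ⟨rfl, h2, h3⟩))⟩
          · exact ⟨-1, Or.inr (Or.inr (Or.inr ⟨rfl, h3⟩))⟩
    obtain ⟨k, hk⟩ := key
    refine ⟨k, fun x hx y hy => ?_⟩
    have hx1 : (p : ℝ) ≤ x := hx.1
    have hx2 : (x : ℝ) ≤ q := hx.2
    have hy1 : (p : ℝ) ≤ y := hy.1
    have hy2 : (y : ℝ) ≤ q := hy.2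
    simp only [x₁Homeo, Homeomorph.homeomorph_mk_coe, Equiv.coe_fn_mk]
    rcases hk with ⟨rfl, h⟩ | ⟨rfl, h, h'⟩ | ⟨rfl, h, h'⟩ | ⟨rfl, h⟩ <;> norm_num <;>
      split_ifs <;> linarith

/-- The generator `x₀` of `F`. -/
noncomputable def x₀ : F := ⟨MulOpposite.op x₀Homeo, x₀Homeo_isDyadicPL⟩

/-- The generator `x₁` of `F`. -/
noncomputable def x₁ : F := ⟨MulOpposite.op x₁Homeo, x₁Homeo_isDyadicPL⟩

/-- The standard finite symmetric generating set of `F`. -/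
noncomputable def X : Set F := {x₀, x₁, x₀⁻¹, x₁⁻¹}

end Thompson

section AutomaticStructures

variable {G : Type*} [Group G]

/-- The group element represented by a word whose letters are elements of `S`. -/
def wordValue {S : Set G} (w : List S) : G := (w.map Subtype.val).prod

/-- The word length `|g|_S`: the least length of a word over `S` that represents `g`. -/
noncomputable def wordLength (S : Set G) (g : G) : ℕ :=
  sInf {n | ∃ w : List S, wordValue w = g ∧ w.length = n}

/-- Two words written as one word of pairs of letters; the shorter word is extended by the padding
symbol `none`. -/
def paddedPair {α : Type*} (u v : List α) : List (Option α × Option α) :=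
  List.zipWithAll Prod.mk u v

/-- The language of the multiplier automaton of `s`: the padded pairs of words `u`, `v` of `K` such
that `u = v s` in the group. -/
def multiplierLanguage {S : Set G} (K : Language S) (s : G) :
    Language (Option S × Option S) :=
  {z | ∃ u ∈ K, ∃ v ∈ K, wordValue u = wordValue v * s ∧ z = paddedPair u v}

/-- `K` is the language of an automatic structure on `G` with alphabet `S`. -/
structure IsAutomaticStructure (S : Set G) (K : Language S) : Prop where
  finite : S.Finite
  symmetric : ∀ s ∈ S, s⁻¹ ∈ S
  generates : Subgroup.closure S = ⊤
  wordAcceptor : K.IsRegular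
  represents : ∀ g : G, ∃ w ∈ K, wordValue w = g
  /-- The multiplier automata. An automaton for the pairs with `u = v` in `G`, which is often
  required too, exists automatically, by composing those for `s` and `s⁻¹`. -/
  multiplier : ∀ s ∈ S, (multiplierLanguage K s).IsRegular

end AutomaticStructures

/-! `level` records which translate of `[1/2, 3/4)` under `x₀` contains a point. For `p < q`, one
letter changes `level q` and `level q - 2 * level p` by at most one each, so following two points
bounds word lengths from below. Near `0` a letter multiplies a point by a power of two, near `1` the
distance from `1`; a factor `3` in that coordinate can be created or removed only in the middle.

`doubleBump n k` takes a left point from `2 ^ (-n-1)` to `3 * 2 ^ a`, and the distance from `1` of a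
right point from `3 * 2 ^ (-n-3)` to `2 ^ b`. A path to it must bring both points to the middle.
Near-geodesic paths for `k = m` must treat the right point first, those for `k = -m` the left point
first (`right_first`, `left_first`); the wrong order costs about `2 * m` more letters. So at time `2
* n` the distance of the right point from `1` is a power of two on the first path and three times
one on the second.

The two elements differ by the fixed element `x₀ ^ (-2m)`, so in an automatic structure the two
prefixes of length `2 * n` differ by some `d` in a finite set independent of `n`. For large `n` the
right point is then so deep near `1` that `d` only scales its distance by a power of two, which
contradicts `three_mul_zpow_ne`. -/

namespace Thompson

/-! ### The action on the unit interval -/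

/-- The image of a point under an element of `F`. -/
def act (f : F) (x : unitInterval) : unitInterval := f.1.unop x

theorem act_one (x : unitInterval) : act 1 x = x := rfl

theorem act_mul (f g : F) (x : unitInterval) : act (f * g) x = act g (act f x) := rfl

theorem act_inv_act (f : F) (x : unitInterval) : act f⁻¹ (act f x) = x := by
  rw [← act_mul, mul_inv_cancel, act_one]

theorem act_act_inv (f : F) (x : unitInterval) : act f (act f⁻¹ x) = x := by
  rw [← act_mul, inv_mul_cancel, act_one]

theorem ext_act {f g : F} (h : ∀ x, act f x = act g x) : f = g :=
  Subtype.ext (MulOpposite.unop_injective (Homeomorph.ext h))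

theorem act_strictMono (f : F) : StrictMono (act f) := IsDyadicPL.strictMono f.2

theorem act_zero (f : F) : act f 0 = 0 := by
  have h1 : act f 0 ≤ act f (act f⁻¹ 0) := (act_strictMono f).monotone unitInterval.nonneg'
  rw [act_act_inv] at h1
  exact le_antisymm h1 unitInterval.nonneg'

theorem act_one_right (f : F) : act f 1 = 1 := by
  have h1 : act f (act f⁻¹ 1) ≤ act f 1 := (act_strictMono f).monotone unitInterval.le_one'
  rw [act_act_inv] at h1
  exact le_antisymm unitInterval.le_one' h1

theorem act_pos (f : F) {x : unitInterval} (hx : (0 : ℝ) < x) : (0 : ℝ) < act f x := by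
  have h := act_strictMono f (show (0 : unitInterval) < x from hx)
  rw [act_zero] at h
  exact h

theorem act_lt_one (f : F) {x : unitInterval} (hx : (x : ℝ) < 1) : (act f x : ℝ) < 1 := by
  have h := act_strictMono f (show x < (1 : unitInterval) from hx)
  rw [act_one_right] at h
  exact h

theorem act_lt_act (f : F) {x y : unitInterval} (h : (x : ℝ) < y) :
    (act f x : ℝ) < act f y :=
  act_strictMono f (show x < y from h)

theorem act_x₀ (x : unitInterval) : (act x₀ x : ℝ) = if (x : ℝ) ≤ 1 / 4 then 2 * (x : ℝ) else
    if (x : ℝ) ≤ 1 / 2 then x + 1 / 4 else (x + 1) / 2 := rfl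

theorem act_x₁ (x : unitInterval) : (act x₁ x : ℝ) = if (x : ℝ) ≤ 1 / 2 then (x : ℝ) else
    if (x : ℝ) ≤ 5 / 8 then 2 * x - 1 / 2 else if (x : ℝ) ≤ 3 / 4 then x + 1 / 8 else
      (x + 1) / 2 := rfl

theorem act_x₀_inv (y : unitInterval) : (act x₀⁻¹ y : ℝ) = if (y : ℝ) ≤ 1 / 2 then (y : ℝ) / 2
    else if (y : ℝ) ≤ 3 / 4 then y - 1 / 4 else 2 * y - 1 := rfl

theorem act_x₁_inv (y : unitInterval) : (act x₁⁻¹ y : ℝ) = if (y : ℝ) ≤ 1 / 2 then (y : ℝ) else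
    if (y : ℝ) ≤ 3 / 4 then y / 2 + 1 / 4 else if (y : ℝ) ≤ 7 / 8 then y - 1 / 8 else
      2 * y - 1 := rfl

theorem mem_X_cases {l : F} (hl : l ∈ X) : l = x₀ ∨ l = x₁ ∨ l = x₀⁻¹ ∨ l = x₁⁻¹ := by
  simpa [X] using hl

/-! ### Levels and how the generators change them -/

/-- The index of the translate of the fundamental domain `[1/2, 3/4)` of `x₀` that contains a
point of the open unit interval. -/
noncomputable def level (x : ℝ) : ℤ :=
  if x < 1 / 2 then ⌊Real.logb 2 x⌋ + 1 else -⌈Real.logb 2 (1 - x)⌉ - 1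

theorem level_two_mul {x : ℝ} (h0 : 0 < x) (h : x < 1 / 4) : level (2 * x) = level x + 1 := by
  rw [level, level, if_pos (by linarith), if_pos (by linarith),
    Real.logb_mul two_ne_zero h0.ne', Real.logb_self_eq_one one_lt_two, add_comm (1 : ℝ),
    Int.floor_add_one]

theorem level_half {x : ℝ} (h : 1 / 2 ≤ x) (h1 : x < 1) :
    level ((x + 1) / 2) = level x + 1 := by
  rw [level, level, if_neg (by linarith), if_neg (by linarith),
    show 1 - (x + 1) / 2 = (1 - x) / 2 by ring, Real.logb_div (by linarith) two_ne_zero,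
    Real.logb_self_eq_one one_lt_two, Int.ceil_sub_one]
  ring

theorem level_eq_zero {x : ℝ} (h : 1 / 2 ≤ x) (h1 : x < 3 / 4) : level x = 0 := by
  rw [level, if_neg (by linarith)]
  have : ⌈Real.logb 2 (1 - x)⌉ = -1 := by
    rw [Int.ceil_eq_iff]
    constructor
    · rw [Real.lt_logb_iff_rpow_lt one_lt_two (by linarith)]
      norm_num [Real.rpow_neg]
      linarith
    · rw [Real.logb_le_iff_le_rpow one_lt_two (by linarith)]
      norm_num [Real.rpow_neg]
      linarith
  rw [this]
  norm_num

theorem level_eq_one {x : ℝ} (h : 3 / 4 ≤ x) (h1 : x < 7 / 8) : level x = 1 := by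
  have := level_half (x := 2 * x - 1) (by linarith) (by linarith)
  rw [level_eq_zero (x := 2 * x - 1) (by linarith) (by linarith)] at this
  rwa [show (2 * x - 1 + 1) / 2 = x by ring] at this

theorem level_eq_neg_one {x : ℝ} (h : 1 / 4 ≤ x) (h1 : x < 1 / 2) : level x = -1 := by
  rw [level, if_pos (by linarith)]
  have : ⌊Real.logb 2 x⌋ = -2 := by
    rw [Int.floor_eq_iff]
    constructor
    · rw [Real.le_logb_iff_rpow_le one_lt_two (by linarith)]
      norm_num [Real.rpow_neg]
      linarith
    · rw [Real.logb_lt_iff_lt_rpow one_lt_two (by linarith)]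
      norm_num [Real.rpow_neg]
      linarith
  rw [this]
  norm_num

theorem half_le_of_level_nonneg {x : ℝ} (h0 : 0 < x) (h : 0 ≤ level x) : 1 / 2 ≤ x := by
  by_contra! hx
  rw [level, if_pos hx] at h
  have h2 : (-1 : ℤ) ≤ ⌊Real.logb 2 x⌋ := by omega
  rw [Int.le_floor, Real.le_logb_iff_rpow_le one_lt_two h0] at h2
  norm_num [Real.rpow_neg] at h2
  linarith

theorem level_nonneg {x : ℝ} (h : 1 / 2 ≤ x) (h1 : x < 1) : 0 ≤ level x := by
  rw [level, if_neg (by linarith)]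
  have h2 : ⌈Real.logb 2 (1 - x)⌉ ≤ -1 := by
    rw [Int.ceil_le, Real.logb_le_iff_le_rpow one_lt_two (by linarith)]
    norm_num [Real.rpow_neg]
    linarith
  omega

theorem three_quarters_le_of_level_pos {x : ℝ} (h0 : 0 < x) (h : 1 ≤ level x) :
    3 / 4 ≤ x := by
  by_contra! hx
  have h1 := half_le_of_level_nonneg h0 (by omega)
  rw [level_eq_zero h1 hx] at h
  omega

theorem level_act_x₀ {x : unitInterval} (h0 : (0 : ℝ) < x) (h1 : (x : ℝ) < 1) :
    level (act x₀ x) = level x + 1 := by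
  rw [act_x₀]
  rcases lt_or_ge (x : ℝ) (1 / 4) with h | h
  · rw [if_pos h.le, level_two_mul h0 h]
  rcases lt_or_ge (x : ℝ) (1 / 2) with h' | h'
  · rw [level_eq_neg_one h h']
    split_ifs <;> exact level_eq_zero (by linarith) (by linarith)
  · rw [← level_half h' h1]
    congr 1
    split_ifs <;> linarith

/-- The cut is at `5/8` because `x₁` sends it to `3/4`, the left end of the translate of level one.
-/
theorem level_act_x₁ {x : unitInterval} (h1 : (x : ℝ) < 1) :
    level (act x₁ x) = level x + if (x : ℝ) < 5 / 8 then 0 else 1 := by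
  rw [act_x₁]
  rcases lt_or_ge (x : ℝ) (1 / 2) with h | h
  · rw [if_pos h.le, if_pos (by linarith), add_zero]
  rcases lt_or_ge (x : ℝ) (5 / 8) with h' | h'
  · rw [level_eq_zero (x := x) h (by linarith), if_pos h']
    split_ifs <;> exact level_eq_zero (by linarith) (by linarith)
  rw [if_neg (c := (x : ℝ) < 5 / 8) (by linarith)]
  rcases lt_or_ge (x : ℝ) (3 / 4) with h3 | h3
  · rw [level_eq_zero (x := x) h h3]
    split_ifs <;> first | linarith | exact level_eq_one (by linarith) (by linarith)
  · rw [← level_half h h1]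
    congr 1
    split_ifs <;> linarith

theorem level_act_x₀_inv {x : unitInterval} (h0 : (0 : ℝ) < x) (h1 : (x : ℝ) < 1) :
    level (act x₀⁻¹ x) = level x - 1 := by
  have h := level_act_x₀ (act_pos x₀⁻¹ h0) (act_lt_one x₀⁻¹ h1)
  rw [act_act_inv] at h
  omega

theorem level_act_x₀_zpow {x : unitInterval} (h0 : (0 : ℝ) < x) (h1 : (x : ℝ) < 1) (k : ℤ) :
    level (act (x₀ ^ k) x) = level x + k := by
  induction k using Int.induction_on with
  | zero => simp [act_one]
  | succ k ih =>
    rw [zpow_add_one, act_mul, level_act_x₀ (act_pos _ h0) (act_lt_one _ h1), ih]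
    ring
  | pred k ih =>
    rw [zpow_sub_one, act_mul, level_act_x₀_inv (act_pos _ h0) (act_lt_one _ h1), ih]
    ring

/-- Applying a generator to two points `p < q` changes each of `level q` and
`level q - 2 * level p` by at most one. -/
theorem level_act_lipschitz {l : F} (hl : l ∈ X) {p q : unitInterval} (h0 : (0 : ℝ) < p)
    (hpq : (p : ℝ) < q) (h1 : (q : ℝ) < 1) :
    |level (act l q) - level q| ≤ 1 ∧
      |(level (act l q) - 2 * level (act l p)) - (level q - 2 * level p)| ≤ 1 := by
  have key : ∀ {p q : unitInterval}, (0 : ℝ) < p → (p : ℝ) < q → (q : ℝ) < 1 →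
      |level (act x₁ q) - level q| ≤ 1 ∧
      |(level (act x₁ q) - 2 * level (act x₁ p)) - (level q - 2 * level p)| ≤ 1 := by
    intro p q h0 hpq h1
    rw [level_act_x₁ h1, level_act_x₁ (hpq.trans h1)]
    simp only [abs_le]
    -- A change of `-2` would need `p` to move up while `q` stays, but `5/8 ≤ p` forces `5/8 ≤ q`.
    split_ifs <;> first | omega | (exfalso; linarith)
  rcases mem_X_cases hl with rfl | rfl | rfl | rfl
  · rw [level_act_x₀ (h0.trans hpq) h1, level_act_x₀ h0 (hpq.trans h1)]
    simp only [abs_le]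
    omega
  · exact key h0 hpq h1
  · rw [level_act_x₀_inv (h0.trans hpq) h1, level_act_x₀_inv h0 (hpq.trans h1)]
    simp only [abs_le]
    omega
  · have h := key (act_pos x₁⁻¹ h0) (act_lt_act x₁⁻¹ hpq) (act_lt_one x₁⁻¹ h1)
    rw [act_act_inv, act_act_inv] at h
    simp only [abs_le] at h ⊢
    omega

theorem level_act_prod_lipschitz {w : List F} (hw : ∀ l ∈ w, l ∈ X) {p q : unitInterval}
    (h0 : (0 : ℝ) < p) (hpq : (p : ℝ) < q) (h1 : (q : ℝ) < 1) :
    |level (act w.prod q) - level q| ≤ w.length ∧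
      |(level (act w.prod q) - 2 * level (act w.prod p)) - (level q - 2 * level p)|
        ≤ w.length := by
  induction w generalizing p q with
  | nil => simp [act_one]
  | cons l w ih =>
    have h := level_act_lipschitz (hw l (by simp)) h0 hpq h1
    have h' := ih (fun l hl => hw l (by simp [hl])) (act_pos l h0) (act_lt_act l hpq)
      (act_lt_one l h1)
    rw [List.prod_cons, act_mul, act_mul, List.length_cons]
    simp only [abs_le] at h h' ⊢
    push_cast
    omega

/-! ### Scaling by powers of two near the endpoints -/

/-- Near `1` the generators act by scaling the distance from `1` by powers of two. -/
theorem one_sub_act_eq {l : F} (hl : l ∈ X) {q : unitInterval} (h : 3 / 4 ≤ (q : ℝ))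
    (h' : 3 / 4 ≤ (act l q : ℝ)) : ∃ k : ℤ, 1 - (act l q : ℝ) = 2 ^ k * (1 - q) := by
  rcases mem_X_cases hl with rfl | rfl | rfl | rfl
  · refine ⟨-1, ?_⟩
    rw [act_x₀]
    norm_num
    split_ifs <;> linarith
  · refine ⟨-1, ?_⟩
    rw [act_x₁]
    norm_num
    split_ifs <;> linarith
  · refine ⟨1, ?_⟩
    rw [act_x₀_inv]
    norm_num
    split_ifs <;> linarith
  · refine ⟨1, ?_⟩
    -- Only here is the bound on the image needed: it forces `7/8 ≤ q`, where `x₁⁻¹` has slope two.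
    rw [act_x₁_inv] at h' ⊢
    norm_num
    split_ifs at h' ⊢ <;> linarith

/-- Near `0` the generators act by scaling by powers of two. -/
theorem act_eq_of_lt_half {l : F} (hl : l ∈ X) {p : unitInterval} (h : (p : ℝ) < 1 / 2)
    (h' : (act l p : ℝ) < 1 / 2) : ∃ k : ℤ, (act l p : ℝ) = 2 ^ k * p := by
  rcases mem_X_cases hl with rfl | rfl | rfl | rfl
  · refine ⟨1, ?_⟩
    rw [act_x₀] at h' ⊢
    rw [zpow_one]
    split_ifs at h' ⊢ <;> linarith
  · refine ⟨0, ?_⟩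
    rw [act_x₁, if_pos h.le, zpow_zero, one_mul]
  · refine ⟨-1, ?_⟩
    rw [act_x₀_inv]
    norm_num
    split_ifs <;> linarith
  · refine ⟨0, ?_⟩
    rw [act_x₁_inv, if_pos h.le, zpow_zero, one_mul]

theorem one_sub_act_prod_eq {w : List F} (hw : ∀ l ∈ w, l ∈ X) {q : unitInterval}
    (h : ∀ t ≤ w.length, 3 / 4 ≤ (act (w.take t).prod q : ℝ)) :
    ∃ k : ℤ, 1 - (act w.prod q : ℝ) = 2 ^ k * (1 - q) := by
  induction w generalizing q with
  | nil => exact ⟨0, by simp [act_one]⟩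
  | cons l w ih =>
    have h0 : 3 / 4 ≤ (q : ℝ) := by simpa [act_one] using h 0 (by simp)
    have h1 : 3 / 4 ≤ (act l q : ℝ) := by simpa using h 1 (by simp)
    obtain ⟨k, hk⟩ := one_sub_act_eq (hw l (by simp)) h0 h1
    obtain ⟨k', hk'⟩ := ih (fun l hl => hw l (by simp [hl])) (q := act l q) (fun t ht => by
      simpa [act_mul] using h (t + 1) (by simpa using ht))
    refine ⟨k' + k, ?_⟩
    rw [List.prod_cons, act_mul, hk', hk, zpow_add₀ two_ne_zero, mul_assoc]

theorem act_prod_eq_of_lt_half {w : List F} (hw : ∀ l ∈ w, l ∈ X) {p : unitInterval}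
    (h : ∀ t ≤ w.length, (act (w.take t).prod p : ℝ) < 1 / 2) :
    ∃ k : ℤ, (act w.prod p : ℝ) = 2 ^ k * p := by
  induction w generalizing p with
  | nil => exact ⟨0, by simp [act_one]⟩
  | cons l w ih =>
    have h0 : (p : ℝ) < 1 / 2 := by simpa [act_one] using h 0 (by simp)
    have h1 : (act l p : ℝ) < 1 / 2 := by simpa using h 1 (by simp)
    obtain ⟨k, hk⟩ := act_eq_of_lt_half (hw l (by simp)) h0 h1
    obtain ⟨k', hk'⟩ := ih (fun l hl => hw l (by simp [hl])) (p := act l p) (fun t ht => by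
      simpa [act_mul] using h (t + 1) (by simpa using ht))
    refine ⟨k' + k, ?_⟩
    rw [List.prod_cons, act_mul, hk', hk, zpow_add₀ two_ne_zero, mul_assoc]

theorem three_mul_zpow_ne (a b : ℤ) : (3 : ℝ) * 2 ^ a ≠ 2 ^ b := by
  intro h
  have h3 : (3 : ℝ) = 2 ^ (b - a) := by
    rw [zpow_sub₀ two_ne_zero, ← h, mul_div_cancel_right₀ _ (by positivity)]
  rcases lt_or_ge (b - a) 2 with hc | hc
  · have := zpow_le_zpow_right₀ (one_le_two (α := ℝ)) (show b - a ≤ 1 by omega)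
    rw [← h3] at this
    norm_num at this
  · have := zpow_le_zpow_right₀ (one_le_two (α := ℝ)) hc
    rw [← h3] at this
    norm_num at this

end Thompson

/-! ### The bump elements and the two points followed -/

namespace Thompson

theorem half_le_act_x₀_pow {x : unitInterval} (h : 1 / 2 ≤ (x : ℝ)) (n : ℕ) :
    1 / 2 ≤ (act (x₀ ^ n) x : ℝ) ∧ 1 - (act (x₀ ^ n) x : ℝ) = (1 - x) / 2 ^ n := by
  induction n with
  | zero => simpa [act_one] using h
  | succ n ih =>
    have e : (act x₀ (act (x₀ ^ n) x) : ℝ) = (act (x₀ ^ n) x + 1) / 2 := by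
      rw [act_x₀]
      split_ifs <;> linarith
    rw [pow_succ, act_mul, e]
    refine ⟨by linarith, ?_⟩
    rw [pow_succ, ← div_div, ← ih.2]
    ring

theorem act_x₀_pow_inv_of_le_half {x : unitInterval} (h : (x : ℝ) ≤ 1 / 2) (n : ℕ) :
    (act (x₀ ^ n)⁻¹ x : ℝ) = x / 2 ^ n := by
  rw [← inv_pow]
  induction n with
  | zero => simp [act_one]
  | succ n ih =>
    have h2 : (x : ℝ) / 2 ^ n ≤ 1 / 2 :=
      (div_le_self x.2.1 (one_le_pow₀ one_le_two)).trans h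
    rw [pow_succ, act_mul, act_x₀_inv, ih, if_pos h2, pow_succ, div_div]

/-- A conjugate of `x₁` supported near `1`. -/
noncomputable def rightBump (n : ℕ) : F := (x₀ ^ n)⁻¹ * x₁ * x₀ ^ n

/-- A conjugate of `x₀ * x₁⁻¹` supported near `0`. -/
noncomputable def leftBump (n : ℕ) : F := x₀ ^ n * (x₀ * x₁⁻¹) * (x₀ ^ n)⁻¹

theorem act_rightBump_of_le {x : unitInterval} (h : (x : ℝ) ≤ 1 / 2) (n : ℕ) :
    act (rightBump n) x = x := by
  have h2 : (x : ℝ) / 2 ^ n ≤ 1 / 2 :=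
    (div_le_self x.2.1 (one_le_pow₀ one_le_two)).trans h
  have h3 : act x₁ (act (x₀ ^ n)⁻¹ x) = act (x₀ ^ n)⁻¹ x := by
    apply Subtype.ext
    rw [act_x₁, act_x₀_pow_inv_of_le_half h, if_pos h2]
  rw [rightBump, act_mul, act_mul, h3, act_act_inv]

/-- `x₀ * x₁⁻¹` is the identity on `[3/4, 1]`, and `x₀ ^ n` with `1 ≤ n` pushes `[1/2, 1]` into that
interval. -/
theorem act_leftBump_of_ge {x : unitInterval} (h : 1 / 2 ≤ (x : ℝ)) {n : ℕ} (hn : 1 ≤ n) :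
    act (leftBump n) x = x := by
  set y := act (x₀ ^ n) x with hy
  have h2 : 3 / 4 ≤ (y : ℝ) := by
    have h3 := (half_le_act_x₀_pow h n).2
    have h4 : (1 - (x : ℝ)) / 2 ^ n ≤ (1 - x) / 2 :=
      div_le_div_of_nonneg_left (by linarith [x.2.2]) two_pos (le_self_pow₀ one_le_two (by omega))
    linarith
  have e : (act x₀ y : ℝ) = (y + 1) / 2 := by
    rw [act_x₀]
    split_ifs <;> linarith
  have h3 : act x₁⁻¹ (act x₀ y) = y := by
    apply Subtype.ext
    rw [act_x₁_inv, e]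
    split_ifs <;> linarith
  rw [leftBump, act_mul, act_mul, act_mul, ← hy, h3, hy, act_inv_act]

/-- The supports lie on opposite sides of `1/2`. Commutation allows the bumps to be made in either
order, giving the two competing kinds of short word. -/
theorem leftBump_mul_rightBump {n : ℕ} (hn : 1 ≤ n) :
    leftBump n * rightBump n = rightBump n * leftBump n := by
  apply ext_act
  intro x
  have half : (((⟨1 / 2, by norm_num⟩ : unitInterval)) : ℝ) = 1 / 2 := rfl
  rw [act_mul, act_mul]
  rcases le_total (x : ℝ) (1 / 2) with h | h
  · rw [act_rightBump_of_le h, act_rightBump_of_le]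
    have := (act_strictMono (leftBump n)).monotone
      (show x ≤ (⟨1 / 2, by norm_num⟩ : unitInterval) from h)
    rwa [act_leftBump_of_ge half.ge hn] at this
  · rw [act_leftBump_of_ge h hn, act_leftBump_of_ge _ hn]
    have := (act_strictMono (rightBump n)).monotone
      (show (⟨1 / 2, by norm_num⟩ : unitInterval) ≤ x from h)
    rwa [act_rightBump_of_le half.le n] at this

/-- The point of the support of `leftBump n` whose orbit is followed. -/
noncomputable def leftPoint (n : ℕ) : unitInterval := act (x₀ ^ n)⁻¹ ⟨1 / 2, by norm_num⟩

/-- The point of the support of `rightBump n` whose orbit is followed. -/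
noncomputable def rightPoint (n : ℕ) : unitInterval := act (x₀ ^ n) ⟨5 / 8, by norm_num⟩

theorem leftPoint_coe (n : ℕ) : (leftPoint n : ℝ) = 1 / 2 / 2 ^ n :=
  act_x₀_pow_inv_of_le_half (x := ⟨1 / 2, by norm_num⟩) le_rfl n

theorem leftPoint_le_half (n : ℕ) : (leftPoint n : ℝ) ≤ 1 / 2 := by
  rw [leftPoint_coe]
  exact div_le_self (by norm_num) (one_le_pow₀ one_le_two)

theorem leftPoint_pos (n : ℕ) : (0 : ℝ) < leftPoint n := by
  rw [leftPoint_coe]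
  positivity

theorem half_lt_rightPoint (n : ℕ) : 1 / 2 < (rightPoint n : ℝ) := by
  have h := (half_le_act_x₀_pow (x := ⟨5 / 8, by norm_num⟩) (by norm_num) n).2
  have h2 : (1 - (5 / 8 : ℝ)) / 2 ^ n ≤ 1 - 5 / 8 :=
    div_le_self (by norm_num) (one_le_pow₀ one_le_two)
  rw [rightPoint]
  dsimp only at h
  linarith

theorem one_sub_rightPoint (n : ℕ) : 1 - (rightPoint n : ℝ) = 3 * 2 ^ (-(n : ℤ) - 3) := by
  rw [rightPoint, (half_le_act_x₀_pow (x := ⟨5 / 8, by norm_num⟩) (by norm_num) n).2,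
    zpow_sub₀ two_ne_zero, zpow_neg, zpow_natCast]
  norm_num
  ring

theorem rightPoint_lt_one (n : ℕ) : (rightPoint n : ℝ) < 1 := act_lt_one _ (by norm_num)

theorem level_leftPoint (n : ℕ) : level (leftPoint n) = -n := by
  have h := level_act_x₀_zpow (x := ⟨1 / 2, by norm_num⟩) (by norm_num) (by norm_num) (-n)
  rw [zpow_neg, zpow_natCast, level_eq_zero (x := 1 / 2) le_rfl (by norm_num), zero_add] at h
  exact h

theorem level_rightPoint (n : ℕ) : level (rightPoint n) = n := by
  have h := level_act_x₀_zpow (x := ⟨5 / 8, by norm_num⟩) (by norm_num) (by norm_num) n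
  rw [zpow_natCast, level_eq_zero (x := 5 / 8) (by norm_num) (by norm_num), zero_add] at h
  exact h

theorem act_bumps_leftPoint (n : ℕ) : act (rightBump n * leftBump n) (leftPoint n) =
    act (x₀ ^ n)⁻¹ ⟨5 / 8, by norm_num⟩ := by
  have e : act x₁⁻¹ (act x₀ ⟨1 / 2, by norm_num⟩) = ⟨5 / 8, by norm_num⟩ := by
    apply Subtype.ext
    rw [act_x₁_inv, act_x₀]
    norm_num
  rw [act_mul, act_rightBump_of_le (leftPoint_le_half n), leftBump, leftPoint, act_mul, act_mul,
    act_mul, act_act_inv, e]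

theorem act_bumps_rightPoint {n : ℕ} (hn : 1 ≤ n) :
    act (rightBump n * leftBump n) (rightPoint n) = act (x₀ ^ n) ⟨3 / 4, by norm_num⟩ := by
  have e : act x₁ ⟨5 / 8, by norm_num⟩ = ⟨3 / 4, by norm_num⟩ := by
    apply Subtype.ext
    rw [act_x₁]
    norm_num
  rw [← leftBump_mul_rightBump hn, act_mul, act_leftBump_of_ge (half_lt_rightPoint n).le hn,
    rightBump, rightPoint, act_mul, act_mul, act_inv_act, e]

/-- The element that combines the two bumps with a translation. -/
noncomputable def doubleBump (n : ℕ) (k : ℤ) : F := rightBump n * leftBump n * x₀ ^ k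

theorem level_act_doubleBump_leftPoint (n : ℕ) (k : ℤ) :
    level (act (doubleBump n k) (leftPoint n)) = -n + k := by
  rw [doubleBump, act_mul, act_bumps_leftPoint, ← act_mul, ← zpow_natCast, ← zpow_neg,
    ← zpow_add, level_act_x₀_zpow (by norm_num) (by norm_num)]
  rw [level_eq_zero (x := 5 / 8) (by norm_num) (by norm_num), zero_add]

theorem level_act_doubleBump_rightPoint {n : ℕ} (hn : 1 ≤ n) (k : ℤ) :
    level (act (doubleBump n k) (rightPoint n)) = n + k + 1 := by
  rw [doubleBump, act_mul, act_bumps_rightPoint hn, ← act_mul, ← zpow_natCast,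
    ← zpow_add, level_act_x₀_zpow (by norm_num) (by norm_num)]
  rw [level_eq_one (x := 3 / 4) (by norm_num) (by norm_num)]
  ring

theorem act_doubleBump_leftPoint {n : ℕ} {k : ℤ} (h : k < n) :
    ∃ a : ℤ, (act (doubleBump n k) (leftPoint n) : ℝ) = 3 * 2 ^ a := by
  -- One factor `x₀⁻¹` is split off to bring `5/8` to `3/8`, below `1/2`, where further factors just
  -- halve; `k < n` guarantees that it is available.
  obtain ⟨j, hj⟩ : ∃ j : ℕ, -(n : ℤ) + k = -1 + -(j : ℤ) := ⟨(n - k - 1).toNat, by omega⟩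
  refine ⟨-(j : ℤ) - 3, ?_⟩
  have e : act x₀⁻¹ ⟨5 / 8, by norm_num⟩ = ⟨3 / 8, by norm_num⟩ := by
    apply Subtype.ext
    rw [act_x₀_inv]
    norm_num
  rw [doubleBump, act_mul, act_bumps_leftPoint, ← act_mul, ← zpow_natCast, ← zpow_neg,
    ← zpow_add, hj, zpow_add, act_mul, zpow_neg_one, e, zpow_neg, zpow_natCast,
    act_x₀_pow_inv_of_le_half (by norm_num), zpow_sub₀ two_ne_zero, zpow_neg, zpow_natCast]
  norm_num
  ring

theorem one_sub_act_doubleBump_rightPoint {n : ℕ} (hn : 1 ≤ n) {k : ℤ} (h : -n ≤ k) :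
    ∃ a : ℤ, 1 - (act (doubleBump n k) (rightPoint n) : ℝ) = 2 ^ a := by
  obtain ⟨j, hj⟩ : ∃ j : ℕ, (n : ℤ) + k = (j : ℤ) := ⟨(n + k).toNat, by omega⟩
  refine ⟨-(j : ℤ) - 2, ?_⟩
  rw [doubleBump, act_mul, act_bumps_rightPoint hn, ← act_mul, ← zpow_natCast,
    ← zpow_add, hj, zpow_natCast, (half_le_act_x₀_pow (by norm_num) _).2,
    zpow_sub₀ two_ne_zero, zpow_neg, zpow_natCast]
  norm_num
  ring

/-! ### Upper bounds for word lengths -/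

theorem exists_word_mul {f g : F} {i j : ℕ} (hf : ∃ w : List X, wordValue w = f ∧ w.length = i)
    (hg : ∃ w : List X, wordValue w = g ∧ w.length = j) :
    ∃ w : List X, wordValue w = f * g ∧ w.length = i + j := by
  obtain ⟨u, rfl, rfl⟩ := hf
  obtain ⟨v, rfl, rfl⟩ := hg
  exact ⟨u ++ v, by simp [wordValue], by simp⟩

theorem exists_word_pow {f : F} (hf : f ∈ X) (n : ℕ) :
    ∃ w : List X, wordValue w = f ^ n ∧ w.length = n :=
  ⟨List.replicate n ⟨f, hf⟩, by simp [wordValue], by simp⟩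

theorem exists_word_of_mem {f : F} (hf : f ∈ X) :
    ∃ w : List X, wordValue w = f ∧ w.length = 1 :=
  ⟨[⟨f, hf⟩], by simp [wordValue], rfl⟩

theorem x₀_mem : x₀ ∈ X := by simp [X]
theorem x₁_mem : x₁ ∈ X := by simp [X]
theorem x₀_inv_mem : x₀⁻¹ ∈ X := by simp [X]
theorem x₁_inv_mem : x₁⁻¹ ∈ X := by simp [X]

/-- The word makes the right bump first, so that its return from the left is shortened by `m`. -/
theorem wordLength_doubleBump_le {n m : ℕ} (h : m ≤ n) :
    wordLength X (doubleBump n m) ≤ 4 * n - m + 3 := by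
  have hw := exists_word_mul (exists_word_mul (exists_word_mul (exists_word_mul (exists_word_mul
    (exists_word_pow x₀_inv_mem n) (exists_word_of_mem x₁_mem)) (exists_word_pow x₀_mem (2 * n)))
    (exists_word_of_mem x₀_mem)) (exists_word_of_mem x₁_inv_mem))
    (exists_word_pow x₀_inv_mem (n - m))
  refine (Nat.sInf_le (m := n + 1 + 2 * n + 1 + 1 + (n - m)) ?_).trans (by omega)
  obtain ⟨w, hw, hl⟩ := hw
  refine ⟨w, ?_, hl⟩
  obtain ⟨k, rfl⟩ := Nat.exists_eq_add_of_le h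
  rw [hw, doubleBump, rightBump, leftBump]
  simp only [add_tsub_cancel_left, zpow_natCast, inv_pow, pow_add, two_mul]
  group

/-- The mirror-image word makes the left bump first. -/
theorem wordLength_doubleBump_neg_le {n m : ℕ} (hn : 1 ≤ n) (h : m ≤ n) :
    wordLength X (doubleBump n (-m)) ≤ 4 * n - m + 3 := by
  have hw := exists_word_mul (exists_word_mul (exists_word_mul (exists_word_mul (exists_word_mul
    (exists_word_pow x₀_mem n) (exists_word_of_mem x₀_mem)) (exists_word_of_mem x₁_inv_mem))
    (exists_word_pow x₀_inv_mem (2 * n))) (exists_word_of_mem x₁_mem))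
    (exists_word_pow x₀_mem (n - m))
  refine (Nat.sInf_le (m := n + 1 + 1 + 2 * n + 1 + (n - m)) ?_).trans (by omega)
  obtain ⟨w, hw, hl⟩ := hw
  refine ⟨w, ?_, hl⟩
  rw [doubleBump, ← leftBump_mul_rightBump hn]
  obtain ⟨k, rfl⟩ := Nat.exists_eq_add_of_le h
  rw [hw, rightBump, leftBump]
  simp only [add_tsub_cancel_left, zpow_neg, zpow_natCast, inv_pow, pow_add, two_mul]
  group

end Thompson

/-! ### Fellow travelling in automatic structures -/

section FellowTravelling

variable {G : Type*} [Group G]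

theorem filterMap_fst_paddedPair {α : Type*} (u v : List α) :
    (paddedPair u v).filterMap Prod.fst = u := by
  unfold paddedPair
  induction u generalizing v with
  | nil => simp
  | cons a u ih =>
    cases v with
    | nil => simp [List.filterMap_map]
    | cons b v => simp [ih]

theorem filterMap_snd_paddedPair {α : Type*} (u v : List α) :
    (paddedPair u v).filterMap Prod.snd = v := by
  unfold paddedPair
  induction u generalizing v with
  | nil => simp [List.filterMap_map]
  | cons a u ih =>
    cases v with
    | nil => simp
    | cons b v => simp [ih]

theorem take_paddedPair {α : Type*} (u v : List α) (t : ℕ) :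
    (paddedPair u v).take t = paddedPair (u.take t) (v.take t) := by
  unfold paddedPair
  induction u generalizing v t with
  | nil => simp [List.map_take]
  | cons a u ih =>
    cases t with
    | zero => simp
    | succ t =>
      cases v with
      | nil => simp [List.map_take]
      | cons b v => simp [ih]

theorem wordValue_append {S : Set G} (u v : List S) :
    wordValue (u ++ v) = wordValue u * wordValue v := by
  simp [wordValue]

/-- The words of `K` that represent elements differing by `r` fellow travel: their simultaneous
prefixes differ by elements of a finite set. -/
def FellowTravels {S : Set G} (K : Language S) (r : G) : Prop :=
  ∃ R : Set G, R.Finite ∧ ∀ u ∈ K, ∀ v ∈ K, wordValue u = wordValue v * r →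
    ∀ t, ∃ d ∈ R, wordValue (u.take t) = wordValue (v.take t) * d

/-- An intermediate word of `K` exists because `K` represents every element; it fellow travels with
both given words. -/
theorem FellowTravels.mul {S : Set G} {K : Language S} (hK : ∀ g : G, ∃ w ∈ K, wordValue w = g)
    {r s : G} (hr : FellowTravels K r) (hs : FellowTravels K s) : FellowTravels K (r * s) := by
  obtain ⟨R, hR, h⟩ := hr
  obtain ⟨R', hR', h'⟩ := hs
  refine ⟨Set.image2 (· * ·) R R', hR.image2 _ hR', fun u hu v hv huv t => ?_⟩
  obtain ⟨z, hz, hzv⟩ := hK (wordValue v * r)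
  obtain ⟨d, hd, e⟩ := h z hz v hv hzv t
  obtain ⟨d', hd', e'⟩ := h' u hu z hz (by rw [huv, hzv, mul_assoc]) t
  exact ⟨d * d', ⟨d, hd, d', hd', rfl⟩, by rw [e', e, mul_assoc]⟩

theorem FellowTravels.inv {S : Set G} {K : Language S} {r : G} (hr : FellowTravels K r) :
    FellowTravels K r⁻¹ := by
  obtain ⟨R, hR, h⟩ := hr
  refine ⟨(·⁻¹) '' R, hR.image _, fun u hu v hv huv t => ?_⟩
  obtain ⟨d, hd, e⟩ := h v hv u hu (by rw [huv]; group) t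
  exact ⟨d⁻¹, ⟨d, hd, rfl⟩, by rw [e]; group⟩

/-- Fix, for each live state of the multiplier automaton, one completion to an accepted word. The
difference of two prefixes is determined by the completion of the state they reach, so finitely many
differences occur. -/
theorem IsAutomaticStructure.fellowTravels_of_mem {S : Set G} {K : Language S}
    (hK : IsAutomaticStructure S K) {s : G} (hs : s ∈ S) : FellowTravels K s := by
  obtain ⟨σ, hσ, M, hM⟩ := hK.multiplier s hs
  classical
  let left (z : List (Option S × Option S)) : G := wordValue (z.filterMap Prod.fst)
  let right (z : List (Option S × Option S)) : G := wordValue (z.filterMap Prod.snd)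
  have accepted : ∀ z ∈ M.accepts, left z = right z * s := by
    intro z hz
    rw [hM] at hz
    obtain ⟨u, -, v, -, huv, rfl⟩ := hz
    simpa only [left, right, filterMap_fst_paddedPair, filterMap_snd_paddedPair] using huv
  -- The value `[]` at states with no completion is irrelevant: prefixes of accepted words never
  -- reach them.
  let completion (q : σ) : List (Option S × Option S) :=
    if h : ∃ y, M.evalFrom q y ∈ M.accept then h.choose else []
  refine ⟨Set.range fun q => right (completion q) * s * (left (completion q))⁻¹,
    Set.finite_range _, fun u hu v hv huv t => ?_⟩
  have hz : paddedPair u v ∈ M.accepts := by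
    rw [hM]
    exact ⟨u, hu, v, hv, huv, rfl⟩
  set x := paddedPair (u.take t) (v.take t) with hx
  set q := M.eval x with hq
  have hex : ∃ y, M.evalFrom q y ∈ M.accept := by
    refine ⟨(paddedPair u v).drop t, ?_⟩
    rw [hq, DFA.eval, ← DFA.evalFrom_of_append, hx, ← take_paddedPair, List.take_append_drop]
    exact hz
  have hy : x ++ completion q ∈ M.accepts := by
    change M.evalFrom M.start (x ++ completion q) ∈ M.accept
    rw [DFA.evalFrom_of_append]
    simp only [completion, dif_pos hex]
    exact hex.choose_spec
  have h := accepted _ hy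
  simp only [left, right, List.filterMap_append, wordValue_append, hx, filterMap_fst_paddedPair,
    filterMap_snd_paddedPair] at h
  refine ⟨_, ⟨q, rfl⟩, ?_⟩
  simp only [left, right]
  rw [← mul_assoc, ← mul_assoc, eq_mul_inv_iff_mul_eq]
  exact h

theorem IsAutomaticStructure.fellowTravels [Nontrivial G] {S : Set G} {K : Language S}
    (hK : IsAutomaticStructure S K) (r : G) : FellowTravels K r := by
  obtain ⟨s, hs⟩ : S.Nonempty := by
    rw [Set.nonempty_iff_ne_empty]
    intro h
    have := hK.generates
    rw [h, Subgroup.closure_empty] at this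
    exact bot_ne_top this
  have hr : r ∈ Subgroup.closure S := hK.generates ▸ Subgroup.mem_top r
  induction hr using Subgroup.closure_induction with
  | mem s hs => exact hK.fellowTravels_of_mem hs
  | one =>
    have h := hK.fellowTravels_of_mem hs
    simpa using h.mul hK.represents h.inv
  | mul _ _ _ _ h h' => exact h.mul hK.represents h'
  | inv _ _ h => exact h.inv

end FellowTravelling

/-! ### The order of visits on short paths -/

namespace Thompson

/-- A walk of `(α, β)` along which both `β` and `β - 2 * α` change by at most one in each step. -/
def IsLevelWalk (α β : ℕ → ℤ) : Prop :=
  ∀ i j : ℕ, i ≤ j → |β j - β i| ≤ j - i ∧ |(β j - 2 * α j) - (β i - 2 * α i)| ≤ j - i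

/-- A short walk that ends further right visits the right side first. -/
theorem IsLevelWalk.right_first {α β : ℕ → ℤ} (H : IsLevelWalk α β) {n m c e i j : ℕ}
    (hα : α 0 = -n) (hβ : β 0 = n) (hαe : α e = -n + m) (hβe : β e = n + m + 1)
    (he : e + m ≤ 4 * n + 3 + c) (hm : c + 2 < 2 * m) (hn : c + 2 < n)
    (hi : i ≤ e) (hαi : 0 ≤ α i) (hj : j ≤ e) (hβj : β j ≤ 0) :
    2 * n ≤ e ∧ (∀ t, 2 * n ≤ t → t ≤ e → 1 ≤ β t) ∧ (n : ℤ) - c - 2 ≤ β (2 * n) := by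
  simp only [IsLevelWalk, abs_le] at H
  -- In the other order, reaching `α i ≥ 0` and then `β j ≤ 0` takes `3 * n` steps, since `β - 2 *
  -- α` starts at `3 * n`, and the climb to `β e` takes `n + m + 1` more: too long by `hm`.
  have order : ∀ j ≤ e, β j ≤ 0 → j < i := by
    intro j hj hβj
    by_contra! hij
    have h1 := H 0 i (by omega)
    have h2 := H i j hij
    have h3 := H j e hj
    push_cast at h1
    omega
  have hji := order j hj hβj
  have h2n : 2 * n ≤ i := by
    have h1 := H 0 j (by omega)
    have h2 := H j i hji.le
    push_cast at h1
    omega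
  have h3 := H i e hi
  refine ⟨by omega, fun t ht hte => ?_, ?_⟩
  · by_contra! hβt
    have h1 := order t hte (by omega)
    have h2 := H t i h1.le
    omega
  · have h1 := H (2 * n) i h2n
    push_cast at h1
    omega

/-- A short walk that ends further left visits the left side first. -/
theorem IsLevelWalk.left_first {α β : ℕ → ℤ} (H : IsLevelWalk α β) {n m c e i j : ℕ}
    (hα : α 0 = -n) (hβ : β 0 = n) (hαe : α e = -n - m) (hβe : β e = n - m + 1)
    (he : e + m ≤ 4 * n + 3 + c) (hm : c + 2 < 2 * m) (hn : 1 ≤ n)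
    (hi : i ≤ e) (hαi : 0 ≤ α i) (hj : j ≤ e) (hβj : β j ≤ 0) :
    2 * n ≤ e ∧ (∀ t ≤ 2 * n, 1 ≤ β t) := by
  simp only [IsLevelWalk, abs_le] at H
  -- In the other order, `n` steps to `β j ≤ 0` are followed by at least `3 * n + m + 1` more, as `β
  -- - 2 * α` must end at `3 * n + m + 1`.
  have order : ∀ j ≤ e, β j ≤ 0 → i < j := by
    intro j hj hβj
    by_contra! hij
    have h1 := H 0 j (by omega)
    have h2 := H j i hij
    have h3 := H i e hi
    push_cast at h1
    omega
  have h1 := H 0 i (by omega)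
  push_cast at h1
  have late : ∀ j ≤ e, β j ≤ 0 → 3 * n ≤ j := by
    intro j hj hβj
    have h2 := H i j (order j hj hβj).le
    omega
  have h3 := late j hj hβj
  refine ⟨by omega, fun t ht => ?_⟩
  by_contra! hβt
  have h2 := late t (by omega) (by omega)
  omega

theorem isLevelWalk_of_word {w : List F} (hw : ∀ l ∈ w, l ∈ X) {p q : unitInterval}
    (h0 : (0 : ℝ) < p) (hpq : (p : ℝ) < q) (h1 : (q : ℝ) < 1) :
    IsLevelWalk (fun t => level (act (w.take t).prod p))
      (fun t => level (act (w.take t).prod q)) := by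
  intro i j hij
  have e : w.take j = w.take i ++ (w.drop i).take (j - i) := by
    rw [← List.take_add, Nat.add_sub_cancel' hij]
  have h := level_act_prod_lipschitz (w := (w.drop i).take (j - i))
    (fun l hl => hw l (List.mem_of_mem_drop (List.mem_of_mem_take hl)))
    (act_pos (w.take i).prod h0) (act_lt_act (w.take i).prod hpq) (act_lt_one (w.take i).prod h1)
  have hl : (((w.drop i).take (j - i)).length : ℤ) ≤ j - i := by
    have := List.length_take_le (j - i) (w.drop i)
    omega
  simp only [e, List.prod_append, act_mul]
  exact ⟨h.1.trans hl, h.2.trans hl⟩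

/-- A path that ends at `doubleBump n k` brings the left point to the middle. -/
theorem exists_level_nonneg {w : List F} (hw : ∀ l ∈ w, l ∈ X) {n : ℕ} {k : ℤ} (hk : k < n)
    (h : w.prod = doubleBump n k) :
    ∃ i ≤ w.length, 0 ≤ level (act (w.take i).prod (leftPoint n)) := by
  -- Otherwise the left point would only be scaled by powers of two and could not acquire the factor
  -- `3`.
  by_contra! hc
  obtain ⟨a, ha⟩ := act_prod_eq_of_lt_half hw (p := leftPoint n) (fun t ht => by
    by_contra! hge
    exact absurd (level_nonneg hge (act_lt_one _ (by linarith [leftPoint_le_half n])))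
      (not_le.2 (hc t ht)))
  obtain ⟨b, hb⟩ := act_doubleBump_leftPoint hk
  rw [h, hb, leftPoint_coe] at ha
  apply three_mul_zpow_ne b (a + (-1 - n))
  rw [ha, zpow_add₀ two_ne_zero, zpow_sub₀ two_ne_zero, zpow_natCast]
  norm_num

/-- A path that ends at `doubleBump n k` brings the right point to the middle. -/
theorem exists_level_nonpos {w : List F} (hw : ∀ l ∈ w, l ∈ X) {n : ℕ} (hn : 1 ≤ n) {k : ℤ}
    (hk : -n ≤ k) (h : w.prod = doubleBump n k) :
    ∃ i ≤ w.length, level (act (w.take i).prod (rightPoint n)) ≤ 0 := by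
  by_contra! hc
  obtain ⟨a, ha⟩ := one_sub_act_prod_eq hw (q := rightPoint n) (fun t ht =>
    three_quarters_le_of_level_pos (act_pos _ (by linarith [half_lt_rightPoint n]))
      (hc t ht))
  obtain ⟨b, hb⟩ := one_sub_act_doubleBump_rightPoint hn hk
  rw [h, hb, one_sub_rightPoint] at ha
  apply three_mul_zpow_ne (a + (-n - 3)) b
  rw [ha, zpow_add₀ two_ne_zero]
  ring

/-- Halfway along a short path to `doubleBump n m`, the right point is near `1`, at a distance
that is a power of two. -/
theorem halfway_doubleBump {w : List F} (hw : ∀ l ∈ w, l ∈ X) {n m c : ℕ}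
    (hm : c + 2 < 2 * m) (hn : c + 2 < n) (hmn : m < n) (h : w.prod = doubleBump n m)
    (hl : w.length ≤ 4 * n - m + 3 + c) :
    (n : ℤ) - c - 2 ≤ level (act (w.take (2 * n)).prod (rightPoint n)) ∧
      ∃ a : ℤ, 1 - (act (w.take (2 * n)).prod (rightPoint n) : ℝ) = 2 ^ a := by
  obtain ⟨i, hi, hαi⟩ := exists_level_nonneg hw (by omega) h
  obtain ⟨j, hj, hβj⟩ := exists_level_nonpos hw (by omega) (by omega) h
  have hpos : (0 : ℝ) < rightPoint n := by linarith [half_lt_rightPoint n]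
  have walk := isLevelWalk_of_word hw (leftPoint_pos n)
    ((leftPoint_le_half n).trans_lt (half_lt_rightPoint n)) (rightPoint_lt_one n)
  obtain ⟨h1, h2, h3⟩ := walk.right_first (n := n) (m := m) (c := c) (e := w.length)
    (by simpa [act_one] using level_leftPoint n) (by simpa [act_one] using level_rightPoint n)
    (by simpa [h] using level_act_doubleBump_leftPoint n m)
    (by simpa [h] using level_act_doubleBump_rightPoint (by omega) m)
    (by omega) hm hn hi hαi hj hβj
  refine ⟨h3, ?_⟩
  -- After time `2 * n` the right point stays near `1`, so its final distance, a power of two, is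
  -- read back to that time.
  obtain ⟨a, ha⟩ := one_sub_act_prod_eq (w := w.drop (2 * n))
    (fun l hl => hw l (List.mem_of_mem_drop hl))
    (q := act (w.take (2 * n)).prod (rightPoint n)) (fun t ht => by
      rw [← act_mul, ← List.prod_append, ← List.take_add]
      rw [List.length_drop] at ht
      exact three_quarters_le_of_level_pos (act_pos _ hpos) (h2 _ (by omega) (by omega)))
  rw [← act_mul, ← List.prod_append, List.take_append_drop, h] at ha
  obtain ⟨b, hb⟩ := one_sub_act_doubleBump_rightPoint (n := n) (k := m) (by omega) (by omega)
  refine ⟨b - a, ?_⟩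
  rw [hb] at ha
  rw [zpow_sub₀ two_ne_zero, ha]
  field_simp

/-- Halfway along a short path to `doubleBump n (-m)`, the distance of the right point from `1`
is three times a power of two. -/
theorem halfway_doubleBump_neg {w : List F} (hw : ∀ l ∈ w, l ∈ X) {n m c : ℕ}
    (hm : c + 2 < 2 * m) (hmn : m < n) (h : w.prod = doubleBump n (-m))
    (hl : w.length ≤ 4 * n - m + 3 + c) :
    ∃ a : ℤ, 1 - (act (w.take (2 * n)).prod (rightPoint n) : ℝ) = 3 * 2 ^ a := by
  obtain ⟨i, hi, hαi⟩ := exists_level_nonneg hw (by omega) h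
  obtain ⟨j, hj, hβj⟩ := exists_level_nonpos hw (by omega) (by omega) h
  have walk := isLevelWalk_of_word hw (leftPoint_pos n)
    ((leftPoint_le_half n).trans_lt (half_lt_rightPoint n)) (rightPoint_lt_one n)
  obtain ⟨-, h2⟩ := walk.left_first (n := n) (m := m) (c := c) (e := w.length)
    (by simpa [act_one] using level_leftPoint n) (by simpa [act_one] using level_rightPoint n)
    (by simpa [h, ← sub_eq_add_neg] using level_act_doubleBump_leftPoint n (-m))
    (by simpa [h, ← sub_eq_add_neg] using
      level_act_doubleBump_rightPoint (n := n) (by omega) (-m))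
    (by omega) hm (by omega) hi hαi hj hβj
  obtain ⟨a, ha⟩ := one_sub_act_prod_eq (w := w.take (2 * n))
    (fun l hl => hw l (List.mem_of_mem_take hl)) (q := rightPoint n) (fun t ht => by
      have ht' : t ≤ 2 * n := ht.trans (List.length_take_le _ _)
      rw [List.take_take, min_eq_left ht']
      exact three_quarters_le_of_level_pos (act_pos _ (by linarith [half_lt_rightPoint n]))
        (h2 t ht'))
  refine ⟨a + (-n - 3), ?_⟩
  rw [ha, one_sub_rightPoint, zpow_add₀ two_ne_zero]
  ring

/-- Words that are short compared with the level of a point near `1` only scale its distance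
from `1`. -/
theorem one_sub_act_prod_eq_of_length_lt {w : List F} (hw : ∀ l ∈ w, l ∈ X) {q : unitInterval}
    (h0 : (0 : ℝ) < q) (h1 : (q : ℝ) < 1) (h : (w.length : ℤ) < level q) :
    ∃ k : ℤ, 1 - (act w.prod q : ℝ) = 2 ^ k * (1 - q) := by
  refine one_sub_act_prod_eq hw fun t ht => three_quarters_le_of_level_pos (act_pos _ h0) ?_
  -- The point `q / 2` is a dummy lower partner: the Lipschitz bound is stated for pairs.
  have hp : (0 : ℝ) < ((⟨q / 2, by linarith, by linarith⟩ : unitInterval) : ℝ) := half_pos h0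
  have hpq : ((⟨q / 2, by linarith, by linarith⟩ : unitInterval) : ℝ) < q := half_lt_self h0
  have := (level_act_prod_lipschitz (w := w.take t) (fun l hl => hw l (List.mem_of_mem_take hl))
    hp hpq h1).1
  have h2 : (w.take t).length ≤ w.length := by simp
  rw [abs_le] at this
  omega

/-! ### The contradiction -/

instance : Nontrivial F := by
  refine ⟨x₀, 1, fun h => ?_⟩
  have := congrArg (fun f => (act f ⟨1 / 2, by norm_num⟩ : ℝ)) h
  simp only [act_x₀, act_one] at this
  norm_num at this

theorem mem_X_of_mem_map_val (w : List X) : ∀ l ∈ w.map Subtype.val, l ∈ X := by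
  intro l hl
  obtain ⟨s, -, rfl⟩ := List.mem_map.1 hl
  exact s.2

/-- Near-geodesic representatives over the standard generators do not all lie in the language of
an automatic structure. -/
theorem not_le_of_isAutomaticStructure {L : Language X} {c : ℕ}
    (hL : ∀ g : F, ∃ w ∈ L, wordValue w = g ∧ w.length ≤ wordLength X g + c)
    {S : Set F} {K : Language S} (hK : IsAutomaticStructure S K) :
    ¬ (Language.map Subtype.val L ≤ Language.map Subtype.val K) := by
  intro hLK
  have lift : ∀ w ∈ L, ∃ u ∈ K, u.map Subtype.val = w.map Subtype.val :=
    fun w hw => hLK ⟨w, hw, rfl⟩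
  set m := c + 2 with hm
  obtain ⟨R, hR, travel⟩ := hK.fellowTravels (x₀ ^ (-2 * m : ℤ))
  choose word hword hvalue hlength using hL
  obtain ⟨B, hB⟩ := (hR.image fun d => (word d).length).bddAbove
  -- `B` bounds the chosen word lengths on `R`, and `n - c - 2 > B` keeps the right point near `1`
  -- while `d` acts.
  set n := B + c + m + 3 with hn
  obtain ⟨u, hu, eu⟩ := lift _ (hword (doubleBump n m))
  obtain ⟨v, hv, ev⟩ := lift _ (hword (doubleBump n (-m)))
  set w := (word (doubleBump n m)).map Subtype.val with hw
  set w' := (word (doubleBump n (-m))).map Subtype.val with hw'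
  have pw : w.prod = doubleBump n m := hvalue _
  have pw' : w'.prod = doubleBump n (-m) := hvalue _
  have lw : w.length ≤ 4 * n - m + 3 + c := by
    rw [hw, List.length_map]
    exact (hlength _).trans (Nat.add_le_add_right (wordLength_doubleBump_le (by omega)) c)
  have lw' : w'.length ≤ 4 * n - m + 3 + c := by
    rw [hw', List.length_map]
    exact (hlength _).trans
      (Nat.add_le_add_right (wordLength_doubleBump_neg_le (by omega) (by omega)) c)
  obtain ⟨d, hd, e⟩ := travel v hv u hu (by
    simp only [wordValue]
    rw [eu, ev, pw, pw', doubleBump, doubleBump, mul_assoc _ (x₀ ^ _), ← zpow_add]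
    congr 2
    ring) (2 * n)
  simp only [wordValue, List.map_take] at e
  rw [eu, ev] at e
  have hdB : (word d).length ≤ B := hB ⟨d, hd, rfl⟩
  obtain ⟨hlevel, a, ha⟩ :=
    halfway_doubleBump (mem_X_of_mem_map_val _) (by omega) (by omega) (by omega) pw lw
  obtain ⟨b, hb⟩ :=
    halfway_doubleBump_neg (mem_X_of_mem_map_val _) (by omega) (by omega) pw' lw'
  have hpos : (0 : ℝ) < rightPoint n := by linarith [half_lt_rightPoint n]
  obtain ⟨k, hk⟩ := one_sub_act_prod_eq_of_length_lt (mem_X_of_mem_map_val (word d))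
    (act_pos (w.take (2 * n)).prod hpos)
    (act_lt_one (w.take (2 * n)).prod (rightPoint_lt_one n)) (by
      rw [List.length_map]
      refine lt_of_lt_of_le ?_ hlevel
      omega)
  rw [ha, show ((word d).map Subtype.val).prod = d from hvalue d, ← act_mul, ← e, hb,
    ← zpow_add₀ two_ne_zero] at hk
  exact three_mul_zpow_ne _ _ hk

end Thompson

theorem theorem1p1 :
    (∀ (L : Language Thompson.X) (c : ℕ),
      (∀ g : Thompson.F, ∃ w ∈ L, wordValue w = g ∧ w.length ≤ wordLength Thompson.X g + c) →
      ∀ (S : Set Thompson.F) (K : Language S), IsAutomaticStructure S K →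
        ¬ (Language.map Subtype.val L ≤ Language.map Subtype.val K)) ∧
    ¬ ∃ K : Language Thompson.X, IsAutomaticStructure Thompson.X K ∧
      ∀ g : Thompson.F, ∃ w ∈ K, wordValue w = g ∧ w.length = wordLength Thompson.X g := by
  refine ⟨fun L c hL S K hK => Thompson.not_le_of_isAutomaticStructure hL hK, ?_⟩
  rintro ⟨K, hK, hgeo⟩
  refine Thompson.not_le_of_isAutomaticStructure (L := K) (c := 0) (fun g => ?_) hK le_rfl
  obtain ⟨w, hw, hv, hl⟩ := hgeo g
  exact ⟨w, hw, hv, hl.le⟩
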